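/- Let $\varphi_1:\mathbb R\to\mathbb R_{\ge 0}$ be an even function with $\varphi_1(0)=0$ that is definable in some o-minimal structure on the real field $(\mathbb R,+,\cdot)$ (definability with real parameters), and such that: (1) $\varphi_1$ is twice continuously differentiable, strictly convex and coercive ($\varphi_1(x)\to+\infty$ as $|x|\to\infty$); (2) for every $c\ge 0$ and $x_2\in\mathbb R$, the set $\{x_1\in\mathbb R : \varphi_1(x_2)-\varphi_1(x_1)-\varphi_1'(x_1)(x_2-x_1)\le c\}$ is bounded; (3) $\varphi_1''(x)>0$ for every $x\in\mathbb R$; (4) $|\varphi_1'(x)|\to+\infty$ as $|x|\to\infty$. Then $\varphi_1$ restricts to a bijection of $\mathbb R_{\ge0}$ onto itself; let $\varphi_1^{-1}:\mathbb R_{\ge 0}\to\mathbb R_{\ge 0}$ be its inverse. Let $\phi(\beta)=\sum_{i=1}^d\varphi_1(\beta_i)$ for $\beta\in\mathbb R^d$, and let $\|\cdot\|$ be any norm on $\mathbb R^d$. Put $S_c=\{\beta\in\mathbb R^d:\phi(\beta)\le c\}$, $R_c=\max\{\|\beta\|:\beta\in S_c\}$ and $\bar S_c=R_c^{-1}S_c$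 for $c>0$. Then $\phi$ admits a non-degenerate horizon shape: there is a compact set $S_\infty\subset\mathbb R^d$ with $0$ in its interior such that $\bar S_c\to S_\infty$ in the Hausdorff distance as $c\to\infty$. Moreover, let $\phi_\infty(\beta)=\inf\{r>0:\beta/r\in S_\infty\}$ be the horizon function of $\phi$. Then there is $\lambda>0$ such that for every $\beta\in\mathbb R^d$ the limit below exists in $\mathbb R$ and $$\phi_\infty(\beta)=\lambda\,\lim_{\eta\to0^+}\eta\,\varphi_1^{-1}\!\left(\phi\!\left(\frac{\beta}{\eta}\right)\right).$$ -/

import Mathlib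

open Set Filter Topology
open scoped Pointwise

noncomputable section

/-- The Bregman divergence `D_φ(β₂, β₁) = φ(β₂) - (φ(β₁) + ⟨∇φ(β₁), β₂ - β₁⟩)`. -/
def bregmanDiv {E : Type*} [NormedAddCommGroup E] [InnerProductSpace ℝ E] [CompleteSpace E]
    (φ : E → ℝ) (β₂ β₁ : E) : ℝ :=
  φ β₂ - (φ β₁ + inner ℝ (gradient φ β₁) (β₂ - β₁))

/-- The standing assumptions on a mirror potential `φ : E → ℝ`, where `E` is a Euclidean space. -/
structure PotentialAssumptions {E : Type*} [NormedAddCommGroup E] [InnerProductSpace ℝ E]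
    [CompleteSpace E] (φ : E → ℝ) : Prop where
  /-- `φ` is twice continuously differentiable. -/
  contDiff : ContDiff ℝ 2 φ
  /-- `φ` is strictly convex. -/
  strictConvex : StrictConvexOn ℝ univ φ
  /-- `φ` is coercive: `φ(β) → +∞` as `‖β‖ → ∞`. -/
  coercive : Tendsto φ (Bornology.cobounded E) atTop
  /-- For `c ≥ 0`, the sublevel sets of `D_φ(β₂, ·)` are bounded. -/
  bregman_bounded : ∀ c : ℝ, 0 ≤ c → ∀ β₂ : E,
    Bornology.IsBounded {β₁ : E | bregmanDiv φ β₂ β₁ ≤ c}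
  /-- The Hessian of `φ` is positive definite everywhere. -/
  hessian_pos : ∀ β v : E, v ≠ 0 → 0 < iteratedFDeriv ℝ 2 φ β ![v, v]
  /-- The gradient of `φ` diverges at infinity. -/
  gradient_diverges : Tendsto (fun β => ‖gradient φ β‖) (Bornology.cobounded E) atTop

/-- `L` is (the language of) an o-minimal structure on the real field `ℝ`: addition and
multiplication are definable (hence so is the order, as `x ≤ y ↔ ∃ z, x + z * z = y`), and every
subset of `ℝ` that is definable with real parameters is a finite union of intervals. The
order-connected subsets of `ℝ` are exactly the intervals of all kinds, including the empty set,
points, half-lines and `ℝ`. -/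
structure IsOMinimalOnReals (L : FirstOrder.Language) [L.Structure ℝ] : Prop where
  definable_add : (univ : Set ℝ).DefinableFun L (fun v : Fin 2 → ℝ => v 0 + v 1)
  definable_mul : (univ : Set ℝ).DefinableFun L (fun v : Fin 2 → ℝ => v 0 * v 1)
  finite_union : ∀ S : Set ℝ, (univ : Set ℝ).Definable₁ L S →
    ∃ F : Set (Set ℝ), F.Finite ∧ (∀ I ∈ F, I.OrdConnected) ∧ S = ⋃₀ F

/-- The assumptions on the one-dimensional potential `φ₁ : ℝ → ℝ` from which a separable potential
is built; definability is with respect to the structure on `ℝ` given by `L`. -/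
structure SeparableAssumptions (L : FirstOrder.Language) [L.Structure ℝ] (φ₁ : ℝ → ℝ) : Prop where
  nonneg : ∀ x, 0 ≤ φ₁ x
  zero : φ₁ 0 = 0
  even : Function.Even φ₁
  definable : (univ : Set ℝ).DefinableFun L (fun v : Fin 1 → ℝ => φ₁ (v 0))
  potential : PotentialAssumptions φ₁

/-- The separable potential `φ(β) = ∑ i, φ₁(β i)` on `ℝ^d`. -/
def separablePotential (d : ℕ) (φ₁ : ℝ → ℝ) (β : EuclideanSpace ℝ (Fin d)) : ℝ :=
  ∑ i, φ₁ (β i)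

section Horizon

variable {E : Type*} [NormedAddCommGroup E] [NormedSpace ℝ E]

/-- The sublevel set `S_c(φ)`. -/
def sublevel (φ : E → ℝ) (c : ℝ) : Set E := {β | φ β ≤ c}

/-- `R_c = max {N β : β ∈ S_c}`, where `N` is the chosen norm. -/
def sublevelRadius (N : Seminorm ℝ E) (φ : E → ℝ) (c : ℝ) : ℝ := sSup (N '' sublevel φ c)

/-- The normalised sublevel set `(1 / R_c) S_c`. -/
def normalizedSublevel (N : Seminorm ℝ E) (φ : E → ℝ) (c : ℝ) : Set E :=
  (sublevelRadius N φ c)⁻¹ • sublevel φ c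

/-- `S` is the horizon shape of `φ` (for the normalising norm `N`): it is compact and the
normalised sublevel sets converge to it in Hausdorff distance as `c → ∞`. The extended distance
is used, so that no convention for empty or unbounded sets intervenes. -/
def IsHorizonShape (N : Seminorm ℝ E) (φ : E → ℝ) (S : Set E) : Prop :=
  IsCompact S ∧ Tendsto (fun c => Metric.hausdorffEDist (normalizedSublevel N φ c) S) atTop (𝓝 0)

/-- A horizon shape is unique. -/
theorem IsHorizonShape.unique {N : Seminorm ℝ E} {φ : E → ℝ} {S T : Set E}
    (hS : IsHorizonShape N φ S) (hT : IsHorizonShape N φ T) : S = T := by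
  have h0 : Metric.hausdorffEDist S T = 0 := by
    have h := hS.2.add hT.2
    rw [add_zero] at h
    refine le_antisymm (ge_of_tendsto' h fun c => ?_) bot_le
    calc Metric.hausdorffEDist S T
        ≤ Metric.hausdorffEDist S (normalizedSublevel N φ c)
          + Metric.hausdorffEDist (normalizedSublevel N φ c) T := Metric.hausdorffEDist_triangle
      _ = _ := by rw [Metric.hausdorffEDist_comm]
  exact (hS.1.isClosed.hausdorffEDist_zero_iff hT.1.isClosed).1 h0

/-- The horizon function of a potential with horizon shape `S`: the Minkowski gauge
`β ↦ inf {r > 0 : β / r ∈ S}`. -/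
def horizonFunction (S : Set E) (β : E) : ℝ := sInf {r : ℝ | 0 < r ∧ r⁻¹ • β ∈ S}

end Horizon

/-- The inverse `ℝ≥0 → ℝ≥0` of `φ₁` restricted to `ℝ≥0`. -/
def nonnegInverse (φ₁ : ℝ → ℝ) : ℝ → ℝ := Function.invFunOn φ₁ (Ici 0)

end

/-! Write `f` for the one-dimensional potential, `φ` for the separable one, and `h_t(x) = t⁻¹
f⁻¹(φ(t x))` (`scaledInverse`), with `t = 1/η`. For `a ≥ 0`, `h_t(x) ≤ a` means `φ(t x) ≤ f(t a)`, a
comparison of two definable functions of `t`. By o-minimality its truth value is eventually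
constant, so `t ↦ h_t(x)` cannot oscillate. Superadditivity of `f` on the nonnegative reals traps it
between the `ℓ^∞` and `ℓ^1` norms of `x`, so it has a finite limit `h(x)`. Changing variables in `t`
gives homogeneity and convexity of the sublevel sets of `φ` gives subadditivity, so `h` is a norm
(`exists_seminorm_tendsto`).

The sublevel set of `φ` at height `f t`, divided by `t`, is `{h_t ≤ 1}`: convex and caught between
two fixed balls. Finite nets then upgrade pointwise convergence `h_t → h` to convergence of these
sets, up to dilations, to the unit ball `K` of `h` (`eventually_subset_smul_closedBall`). Dividing
by radii (`tendsto_hausdorffEDist_normalized`) gives the horizon shape `ρ⁻¹ K`, where `ρ` is the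
maximum of the chosen norm on `K`. Its gauge is `ρ h`, so the factor is `ρ`. -/

/-! ### Tameness at infinity from o-minimality -/

/-- The set where one definable function is at most another is definable. -/
theorem IsOMinimalOnReals.definable_le {L : FirstOrder.Language} [L.Structure ℝ]
    (hL : IsOMinimalOnReals L) {f g : (Fin 1 → ℝ) → ℝ}
    (hf : (univ : Set ℝ).DefinableFun L f) (hg : (univ : Set ℝ).DefinableFun L g) :
    (univ : Set ℝ).Definable L {v | f v ≤ g v} := by
  have hproj (i : Fin 1 ⊕ Fin 1) : (univ : Set ℝ).DefinableFun L
      fun v : Fin 1 ⊕ Fin 1 → ℝ => v i := Set.DefinableFun.proj L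
  have hpull {p : (Fin 1 → ℝ) → ℝ} (hp : (univ : Set ℝ).DefinableFun L p) :
      (univ : Set ℝ).DefinableFun L fun v : Fin 1 ⊕ Fin 1 → ℝ => p (v ∘ Sum.inl) :=
    Set.DefinableFun.comp (fun i => hproj (Sum.inl i)) hp
  -- The order is encoded as `∃ z, f v + z * z = g v`; the extra coordinate `Sum.inr 0` carries `z`
  -- and is then projected away.
  have hsq : (univ : Set ℝ).DefinableFun L
      fun v : Fin 1 ⊕ Fin 1 → ℝ => v (Sum.inr 0) * v (Sum.inr 0) :=
    Set.DefinableFun.comp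
      (g := fun (v : Fin 1 ⊕ Fin 1 → ℝ) (_ : Fin 2) => v (Sum.inr 0))
      (fun _ => hproj _) hL.definable_mul
  have hsum : (univ : Set ℝ).DefinableFun L
      fun v : Fin 1 ⊕ Fin 1 → ℝ => f (v ∘ Sum.inl) + v (Sum.inr 0) * v (Sum.inr 0) := by
    refine Set.DefinableFun.comp (g := fun (v : Fin 1 ⊕ Fin 1 → ℝ) =>
      ![f (v ∘ Sum.inl), v (Sum.inr 0) * v (Sum.inr 0)]) (fun i => ?_) hL.definable_add
    fin_cases i
    · exact hpull hf
    · exact hsq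
  have h := (hsum.ofPred_eq (hpull hg)).image_comp Sum.inl
  convert h using 1
  ext v
  simp only [mem_ofPred_eq, mem_image]
  constructor
  · intro hv
    refine ⟨Sum.elim v fun _ => √(g v - f v), ?_, Sum.elim_comp_inl _ _⟩
    simp only [Sum.elim_comp_inl, Sum.elim_inr, Real.mul_self_sqrt (sub_nonneg.2 hv)]
    ring
  · rintro ⟨w, hw, rfl⟩
    nlinarith [mul_self_nonneg (w (Sum.inr 0))]

/-- A set of reals definable in an o-minimal structure contains all large reals, or none. -/
theorem IsOMinimalOnReals.eventually_mem_or_notMem {L : FirstOrder.Language} [L.Structure ℝ]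
    (hL : IsOMinimalOnReals L) {S : Set ℝ} (hS : (univ : Set ℝ).Definable₁ L S) :
    (∀ᶠ t in atTop, t ∈ S) ∨ ∀ᶠ t in atTop, t ∉ S := by
  obtain ⟨F, hF, hI, rfl⟩ := hL.finite_union S hS
  by_cases h : ∃ I ∈ F, ¬ BddAbove I
  · obtain ⟨I, hIF, hIb⟩ := h
    rw [not_bddAbove_iff] at hIb
    obtain ⟨a, ha, -⟩ := hIb 0
    left
    filter_upwards [eventually_ge_atTop a] with t ht
    obtain ⟨b, hb, hbt⟩ := hIb t
    exact ⟨I, hIF, (hI I hIF).out ha hb ⟨ht, hbt.le⟩⟩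
  · push Not at h
    right
    have hb : BddAbove (⋃₀ F) := by
      rw [sUnion_eq_biUnion]
      exact (hF.bddAbove_biUnion).2 h
    obtain ⟨M, hM⟩ := hb
    filter_upwards [eventually_gt_atTop M] with t ht hmem
    exact absurd (hM hmem) (not_le.2 ht)

/-- At `+∞`, two definable functions are eventually comparable. -/
theorem IsOMinimalOnReals.eventually_le_or_lt {L : FirstOrder.Language} [L.Structure ℝ]
    (hL : IsOMinimalOnReals L) {f g : ℝ → ℝ}
    (hf : (univ : Set ℝ).DefinableFun L (fun v : Fin 1 → ℝ => f (v 0)))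
    (hg : (univ : Set ℝ).DefinableFun L (fun v : Fin 1 → ℝ => g (v 0))) :
    (∀ᶠ t in atTop, f t ≤ g t) ∨ ∀ᶠ t in atTop, g t < f t := by
  simpa using hL.eventually_mem_or_notMem (S := {t | f t ≤ g t}) (hL.definable_le hf hg)

/-- Rescaling the variable of a definable function keeps it definable. -/
theorem IsOMinimalOnReals.definableFun_comp_mul {L : FirstOrder.Language} [L.Structure ℝ]
    (hL : IsOMinimalOnReals L) {f : ℝ → ℝ}
    (hf : (univ : Set ℝ).DefinableFun L (fun v : Fin 1 → ℝ => f (v 0))) (a : ℝ) :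
    (univ : Set ℝ).DefinableFun L (fun v : Fin 1 → ℝ => f (v 0 * a)) := by
  have h : (univ : Set ℝ).DefinableFun L (fun v : Fin 1 → ℝ => v 0 * a) := by
    refine Set.DefinableFun.comp (g := fun (v : Fin 1 → ℝ) => ![v 0, a]) (fun i => ?_)
      hL.definable_mul
    fin_cases i
    · exact Set.DefinableFun.proj L
    · exact L.definableFun_const _ (mem_univ a)
  exact Set.DefinableFun.comp (g := fun (v : Fin 1 → ℝ) (_ : Fin 1) => v 0 * a) (fun _ => h) hf

/-- A finite sum of definable functions is definable. -/
theorem IsOMinimalOnReals.definableFun_sum {L : FirstOrder.Language} [L.Structure ℝ]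
    (hL : IsOMinimalOnReals L) {ι : Type*} (s : Finset ι) {f : ι → (Fin 1 → ℝ) → ℝ}
    (hf : ∀ i, (univ : Set ℝ).DefinableFun L (f i)) :
    (univ : Set ℝ).DefinableFun L (fun v : Fin 1 → ℝ => ∑ i ∈ s, f i v) := by
  classical
  induction s using Finset.induction_on with
  | empty => simpa using L.definableFun_const _ (mem_univ (0 : ℝ))
  | insert i s hi ih =>
    simp only [Finset.sum_insert hi]
    refine Set.DefinableFun.comp (g := fun (v : Fin 1 → ℝ) => ![f i v, ∑ j ∈ s, f j v])
      (fun k => ?_) hL.definable_add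
    fin_cases k
    · exact hf i
    · exact ih

/-! ### One-dimensional even potentials and their inverses -/

/-- Even strictly convex functions on `ℝ` that vanish at `0` and tend to infinity. -/
structure IsEvenPotential (f : ℝ → ℝ) : Prop where
  continuous : Continuous f
  strictConvex : StrictConvexOn ℝ univ f
  even : Function.Even f
  zero : f 0 = 0
  tendsto : Tendsto f atTop atTop

namespace IsEvenPotential

variable {f : ℝ → ℝ} (hf : IsEvenPotential f)
include hf

theorem apply_abs (x : ℝ) : f |x| = f x := by
  rcases abs_choice x with h | h <;> rw [h]
  exact hf.even x

theorem pos {x : ℝ} (hx : x ≠ 0) : 0 < f x := by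
  have hne : x ≠ -x := fun h => hx (by linarith)
  have h := hf.strictConvex.2 (mem_univ x) (mem_univ (-x)) hne
    (show (0 : ℝ) < 1 / 2 by norm_num) (show (0 : ℝ) < 1 / 2 by norm_num) (by norm_num)
  simp only [smul_eq_mul, hf.even x] at h
  rw [show (1 / 2 * x + 1 / 2 * -x : ℝ) = 0 by ring, hf.zero] at h
  linarith

theorem nonneg (x : ℝ) : 0 ≤ f x := by
  rcases eq_or_ne x 0 with rfl | hx
  · exact hf.zero.ge
  · exact (hf.pos hx).le

theorem apply_mul_le {s : ℝ} (hs : 0 ≤ s) (hs1 : s ≤ 1) (x : ℝ) : f (s * x) ≤ s * f x := by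
  have h := hf.strictConvex.convexOn.2 (mem_univ x) (mem_univ 0) hs (sub_nonneg.2 hs1)
    (by ring)
  simpa [hf.zero] using h

theorem strictMonoOn : StrictMonoOn f (Ici 0) := by
  intro x hx y _ hxy
  have hy : 0 < y := lt_of_le_of_lt hx hxy
  have h := hf.apply_mul_le (div_nonneg hx hy.le) ((div_le_one hy).2 hxy.le) y
  rw [div_mul_cancel₀ x hy.ne'] at h
  exact h.trans_lt (mul_lt_of_lt_one_left (hf.pos hy.ne') ((div_lt_one hy).2 hxy))

theorem le_iff {x y : ℝ} (hx : 0 ≤ x) (hy : 0 ≤ y) : f x ≤ f y ↔ x ≤ y :=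
  hf.strictMonoOn.le_iff_le hx hy

theorem lt_iff {x y : ℝ} (hx : 0 ≤ x) (hy : 0 ≤ y) : f x < f y ↔ x < y :=
  hf.strictMonoOn.lt_iff_lt hx hy

/-- Convexity and `f 0 = 0` bound `f a` and `f b` by the fractions `a / (a + b)` and `b / (a + b)`
of `f (a + b)`. -/
theorem superadditive {a b : ℝ} (ha : 0 ≤ a) (hb : 0 ≤ b) : f a + f b ≤ f (a + b) := by
  rcases (add_nonneg ha hb).eq_or_lt with h | h
  · obtain rfl : a = 0 := by linarith
    obtain rfl : b = 0 := by linarith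
    simp [hf.zero]
  · have h1 := hf.apply_mul_le (div_nonneg ha h.le) ((div_le_one h).2 (by linarith)) (a + b)
    have h2 := hf.apply_mul_le (div_nonneg hb h.le) ((div_le_one h).2 (by linarith)) (a + b)
    rw [div_mul_cancel₀ _ h.ne'] at h1 h2
    calc f a + f b ≤ a / (a + b) * f (a + b) + b / (a + b) * f (a + b) := add_le_add h1 h2
      _ = f (a + b) := by field_simp

theorem sum_le {ι : Type*} (s : Finset ι) {a : ι → ℝ} (ha : ∀ i, 0 ≤ a i) :
    ∑ i ∈ s, f (a i) ≤ f (∑ i ∈ s, a i) := by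
  classical
  induction s using Finset.induction_on with
  | empty => simp [hf.zero]
  | insert i s hi ih =>
    rw [Finset.sum_insert hi, Finset.sum_insert hi]
    exact (add_le_add_right ih _).trans
      (hf.superadditive (ha i) (Finset.sum_nonneg fun j _ => ha j))

theorem bijOn : BijOn f (Ici 0) (Ici 0) := by
  refine ⟨fun x _ => hf.nonneg x, hf.strictMonoOn.injOn, fun y hy => ?_⟩
  obtain ⟨M, hM0, hM⟩ :=
    ((eventually_ge_atTop (0 : ℝ)).and (hf.tendsto.eventually_ge_atTop y)).exists
  obtain ⟨x, hx, rfl⟩ := intermediate_value_Icc hM0 hf.continuous.continuousOn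
    (show y ∈ Icc (f 0) (f M) from ⟨hf.zero.trans_le hy, hM⟩)
  exact ⟨x, hx.1, rfl⟩

theorem inverse_nonneg {y : ℝ} (hy : 0 ≤ y) : 0 ≤ nonnegInverse f y :=
  hf.bijOn.surjOn.mapsTo_invFunOn hy

theorem apply_inverse {y : ℝ} (hy : 0 ≤ y) : f (nonnegInverse f y) = y :=
  hf.bijOn.surjOn.rightInvOn_invFunOn hy

theorem inverse_le_iff {x y : ℝ} (hx : 0 ≤ x) (hy : 0 ≤ y) :
    nonnegInverse f y ≤ x ↔ y ≤ f x := by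
  rw [← hf.le_iff (hf.inverse_nonneg hy) hx, hf.apply_inverse hy]

theorem lt_inverse_iff {x y : ℝ} (hx : 0 ≤ x) (hy : 0 ≤ y) :
    x < nonnegInverse f y ↔ f x < y := by
  rw [← hf.lt_iff hx (hf.inverse_nonneg hy), hf.apply_inverse hy]

theorem tendsto_inverse : Tendsto (nonnegInverse f) atTop atTop := by
  refine tendsto_atTop.2 fun b => ?_
  filter_upwards [eventually_ge_atTop (0 : ℝ), eventually_gt_atTop (f (max b 0))] with y hy hb
  exact (le_max_left b 0).trans ((hf.lt_inverse_iff (le_max_right b 0) hy).2 hb).le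

end IsEvenPotential

theorem SeparableAssumptions.isEvenPotential {L : FirstOrder.Language} [L.Structure ℝ]
    {f : ℝ → ℝ} (hf : SeparableAssumptions L f) : IsEvenPotential f where
  continuous := hf.potential.contDiff.continuous
  strictConvex := hf.potential.strictConvex
  even := hf.even
  zero := hf.zero
  tendsto := hf.potential.coercive.mono_left <| by
    rw [Metric.cobounded_eq_cocompact]
    exact atTop_le_cocompact

/-! ### The limit norm -/

section Separable

variable {d : ℕ} {f : ℝ → ℝ}

theorem IsEvenPotential.separable_nonneg (hf : IsEvenPotential f)
    (x : EuclideanSpace ℝ (Fin d)) : 0 ≤ separablePotential d f x :=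
  Finset.sum_nonneg fun i _ => hf.nonneg (x i)

theorem IsEvenPotential.apply_le_separable (hf : IsEvenPotential f)
    (x : EuclideanSpace ℝ (Fin d)) (i : Fin d) : f (x i) ≤ separablePotential d f x :=
  Finset.single_le_sum (f := fun i => f (x i)) (fun i _ => hf.nonneg (x i)) (Finset.mem_univ i)

theorem IsEvenPotential.separable_le (hf : IsEvenPotential f)
    (x : EuclideanSpace ℝ (Fin d)) : separablePotential d f x ≤ f (∑ i, |x i|) := by
  have h := hf.sum_le Finset.univ (a := fun i => |x i|) fun i => abs_nonneg _
  simpa only [hf.apply_abs, separablePotential] using h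

theorem IsEvenPotential.separable_neg (hf : IsEvenPotential f)
    (x : EuclideanSpace ℝ (Fin d)) : separablePotential d f (-x) = separablePotential d f x :=
  Finset.sum_congr rfl fun i _ => hf.even (x i)

theorem IsEvenPotential.separable_zero (hf : IsEvenPotential f) :
    separablePotential d f 0 = 0 := by
  simp [separablePotential, hf.zero]

theorem IsEvenPotential.convexOn_separable (hf : IsEvenPotential f) :
    ConvexOn ℝ univ (separablePotential d f) := by
  refine ⟨convex_univ, fun x _ y _ a b ha hb hab => ?_⟩
  simp only [separablePotential, Finset.smul_sum, ← Finset.sum_add_distrib]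
  exact Finset.sum_le_sum fun i _ =>
    hf.strictConvex.convexOn.2 (mem_univ (x i)) (mem_univ (y i)) ha hb hab

/-- The function whose limit at infinity is the horizon function, up to a factor. -/
noncomputable def scaledInverse (f : ℝ → ℝ) (x : EuclideanSpace ℝ (Fin d)) (t : ℝ) : ℝ :=
  t⁻¹ * nonnegInverse f (separablePotential d f (t • x))

variable (hf : IsEvenPotential f)
include hf

theorem IsEvenPotential.scaledInverse_le_iff {x : EuclideanSpace ℝ (Fin d)} {t a : ℝ}
    (ht : 0 < t) (ha : 0 ≤ a) :
    scaledInverse f x t ≤ a ↔ separablePotential d f (t • x) ≤ f (t * a) := by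
  rw [scaledInverse, inv_mul_le_iff₀ ht,
    hf.inverse_le_iff (mul_nonneg ht.le ha) (hf.separable_nonneg _)]

theorem IsEvenPotential.lt_scaledInverse_iff {x : EuclideanSpace ℝ (Fin d)} {t a : ℝ}
    (ht : 0 < t) (ha : 0 ≤ a) :
    a < scaledInverse f x t ↔ f (t * a) < separablePotential d f (t • x) := by
  rw [← not_le, hf.scaledInverse_le_iff ht ha, not_le]

theorem IsEvenPotential.scaledInverse_nonneg (x : EuclideanSpace ℝ (Fin d)) {t : ℝ}
    (ht : 0 < t) : 0 ≤ scaledInverse f x t :=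
  mul_nonneg (inv_nonneg.2 ht.le) (hf.inverse_nonneg (hf.separable_nonneg _))

theorem IsEvenPotential.scaledInverse_le (x : EuclideanSpace ℝ (Fin d)) {t : ℝ}
    (ht : 0 < t) : scaledInverse f x t ≤ ∑ i, |x i| := by
  rw [hf.scaledInverse_le_iff ht (Finset.sum_nonneg fun i _ => abs_nonneg _)]
  have h := hf.separable_le (t • x)
  simpa [abs_mul, abs_of_pos ht, Finset.mul_sum] using h

theorem IsEvenPotential.abs_le_scaledInverse (x : EuclideanSpace ℝ (Fin d)) (i : Fin d) {t : ℝ}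
    (ht : 0 < t) : |x i| ≤ scaledInverse f x t := by
  have h := (hf.scaledInverse_le_iff ht (hf.scaledInverse_nonneg x ht)).1 le_rfl
  have h2 := (hf.apply_le_separable (t • x) i).trans h
  rw [← hf.apply_abs, hf.le_iff (abs_nonneg _)
    (mul_nonneg ht.le (hf.scaledInverse_nonneg x ht))] at h2
  simp only [PiLp.smul_apply, smul_eq_mul, abs_mul, abs_of_pos ht] at h2
  exact le_of_mul_le_mul_left h2 ht

/-- The scales `t / a`, `t / b` and `t / (a + b)` are chosen so that all three inequalities concern
the same height `f t`; the point for `x + y` is then a convex combination, with weights `a / (a +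
b)` and `b / (a + b)`, of the other two. -/
theorem IsEvenPotential.scaledInverse_add_le_of_le {x y : EuclideanSpace ℝ (Fin d)}
    {a b t : ℝ} (ha : 0 < a) (hb : 0 < b) (ht : 0 < t)
    (hx : scaledInverse f x (t * a⁻¹) ≤ a) (hy : scaledInverse f y (t * b⁻¹) ≤ b) :
    scaledInverse f (x + y) (t * (a + b)⁻¹) ≤ a + b := by
  have hab := add_pos ha hb
  rw [hf.scaledInverse_le_iff (by positivity) (by positivity)] at hx hy ⊢
  rw [inv_mul_cancel_right₀ ha.ne'] at hx
  rw [inv_mul_cancel_right₀ hb.ne'] at hy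
  rw [inv_mul_cancel_right₀ hab.ne']
  have h := hf.convexOn_separable.convex_le (f t) ⟨mem_univ _, hx⟩ ⟨mem_univ _, hy⟩
    (div_nonneg ha.le hab.le) (div_nonneg hb.le hab.le) (by field_simp)
  refine le_trans (le_of_eq ?_) h.2
  congr 1
  rw [smul_smul, smul_smul, smul_add]
  congr 2 <;> field_simp

/-- If the scaled inverses are eventually on one side of each constant, they converge, and the
limit is a seminorm, comparable with the `ℓ^1` and `ℓ^∞` norms. -/
theorem IsEvenPotential.exists_seminorm_tendsto
    (hdich : ∀ (x : EuclideanSpace ℝ (Fin d)) (a : ℝ), 0 ≤ a →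
      (∀ᶠ t in atTop, separablePotential d f (t • x) ≤ f (t * a)) ∨
      ∀ᶠ t in atTop, f (t * a) < separablePotential d f (t • x)) :
    ∃ h : Seminorm ℝ (EuclideanSpace ℝ (Fin d)),
      (∀ x, Tendsto (scaledInverse f x) atTop (𝓝 (h x))) ∧
      (∀ x i, |x i| ≤ h x) ∧ ∀ x, h x ≤ ∑ i, |x i| := by
  have hlim (x : EuclideanSpace ℝ (Fin d)) : ∃ l, Tendsto (scaledInverse f x) atTop (𝓝 l) := by
    -- For `a < b`, the dichotomy at level `a` excludes being frequently below `a` and frequently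
    -- above `b`.
    refine tendsto_of_no_upcrossings dense_univ ?_ ?_ ?_
    · rintro a - b - hab ⟨h1, h2⟩
      rcases lt_or_ge a 0 with ha | ha
      · refine h1 ?_
        filter_upwards [eventually_gt_atTop 0] with t ht
        exact not_lt.2 (ha.le.trans (hf.scaledInverse_nonneg x ht))
      · rcases hdich x a ha with h | h
        · refine h2 ?_
          filter_upwards [h, eventually_gt_atTop 0] with t h ht
          exact not_lt.2 (((hf.scaledInverse_le_iff ht ha).2 h).trans hab.le)
        · refine h1 ?_
          filter_upwards [h, eventually_gt_atTop 0] with t h ht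
          exact not_lt.2 ((hf.lt_scaledInverse_iff ht ha).2 h).le
    · exact isBoundedUnder_of_eventually_le (a := ∑ i, |x i|) <| by
        filter_upwards [eventually_gt_atTop 0] with t ht using hf.scaledInverse_le x ht
    · exact isBoundedUnder_of_eventually_ge (a := 0) <| by
        filter_upwards [eventually_gt_atTop 0] with t ht using hf.scaledInverse_nonneg x ht
  choose h hh using hlim
  have hnonneg (x) : 0 ≤ h x := ge_of_tendsto (hh x) <| by
    filter_upwards [eventually_gt_atTop 0] with t ht using hf.scaledInverse_nonneg x ht
  have hadd (x y) : h (x + y) ≤ h x + h y := by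
    refine le_of_forall_pos_le_add fun ε hε => ?_
    -- The slack makes the levels positive and strictly above the limits, so both bounds hold
    -- eventually.
    have ha : 0 < h x + ε / 2 := by linarith [hnonneg x]
    have hb : 0 < h y + ε / 2 := by linarith [hnonneg y]
    have hscale {c : ℝ} (hc : 0 < c) : Tendsto (fun t : ℝ => t * c⁻¹) atTop atTop :=
      tendsto_id.atTop_mul_const (inv_pos.2 hc)
    have hxt := ((hh x).comp (hscale ha)).eventually_le_const
      (show h x < h x + ε / 2 by linarith)
    have hyt := ((hh y).comp (hscale hb)).eventually_le_const
      (show h y < h y + ε / 2 by linarith)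
    have key := le_of_tendsto ((hh (x + y)).comp (hscale (add_pos ha hb))) <| by
      filter_upwards [hxt, hyt, eventually_gt_atTop 0] with t h1 h2 ht
      exact hf.scaledInverse_add_le_of_le ha hb ht h1 h2
    linarith
  have hpos_smul (s : ℝ) (hs : 0 < s) (x) : h (s • x) = s * h x := by
    refine tendsto_nhds_unique (hh (s • x)) ?_
    have h1 := ((hh x).comp (tendsto_id.atTop_mul_const hs)).const_mul s
    refine h1.congr fun t => ?_
    simp only [Function.comp_apply, scaledInverse, id, smul_smul, mul_inv]
    field_simp
  have hneg (x) : h (-x) = h x := by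
    refine tendsto_nhds_unique (hh (-x)) ((hh x).congr fun t => ?_)
    rw [scaledInverse, scaledInverse, smul_neg, hf.separable_neg]
  have hsum (x) : h x ≤ ∑ i, |x i| := le_of_tendsto (hh x) <| by
    filter_upwards [eventually_gt_atTop 0] with t ht using hf.scaledInverse_le x ht
  have hzero : h 0 = 0 := le_antisymm ((hsum 0).trans (by simp)) (hnonneg 0)
  have hsmul (s : ℝ) (x) : h (s • x) = ‖s‖ * h x := by
    rcases lt_trichotomy s 0 with hs | rfl | hs
    · rw [← hneg, ← neg_smul, hpos_smul _ (neg_pos.2 hs), Real.norm_of_nonpos hs.le]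
    · simp [hzero]
    · rw [hpos_smul _ hs, Real.norm_of_nonneg hs.le]
  exact ⟨Seminorm.of h hadd hsmul, hh, fun x i => ge_of_tendsto (hh x) (by
    filter_upwards [eventually_gt_atTop 0] with t ht using hf.abs_le_scaledInverse x i ht), hsum⟩

end Separable

/-! ### From pointwise convergence of gauges to Hausdorff convergence -/

section Hausdorff

variable {E : Type*} [NormedAddCommGroup E] [NormedSpace ℝ E]

theorem mem_smul_of_norm_le {A : Set E} {δ s : ℝ} (hball : Metric.closedBall 0 δ ⊆ A)
    (hs : 0 < s) {x : E} (hx : ‖x‖ ≤ s * δ) : x ∈ s • A := by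
  rw [mem_smul_set_iff_inv_smul_mem₀ hs.ne']
  refine hball (mem_closedBall_zero_iff.2 ?_)
  rw [norm_smul, Real.norm_of_nonneg (inv_nonneg.2 hs.le)]
  exact inv_mul_le_of_le_mul₀ hs.le (by nlinarith [norm_nonneg x]) hx

theorem add_mem_smul_of_norm_le {A : Set E} (hA : Convex ℝ A) {δ r s : ℝ}
    (hball : Metric.closedBall 0 δ ⊆ A) (hr : 0 ≤ r) (hs : 0 < s) {x y : E} (hx : x ∈ r • A)
    (hy : ‖y‖ ≤ s * δ) : x + y ∈ (r + s) • A := by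
  rw [hA.add_smul hr hs.le]
  exact add_mem_add hx (mem_smul_of_norm_le hball hs hy)

/-- If the gauges of uniformly bounded convex sets `A i`, which all contain a fixed ball, converge
pointwise to a seminorm `p`, then the `A i` converge to its closed unit ball up to dilations. -/
theorem eventually_subset_smul_closedBall [ProperSpace E] {ι : Type*} {l : Filter ι}
    {A : ι → Set E} {p : Seminorm ℝ E} {δ R : ℝ} (hδ : 0 < δ) (hp : Continuous p)
    (hpδ : ∀ x, p x ≤ δ⁻¹ * ‖x‖) (hpR : ∀ x, p x ≤ 1 → ‖x‖ ≤ R)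
    (hconv : ∀ᶠ i in l, Convex ℝ (A i)) (hball : ∀ᶠ i in l, Metric.closedBall 0 δ ⊆ A i)
    (hbdd : ∀ᶠ i in l, A i ⊆ Metric.closedBall 0 R)
    (hin : ∀ x, p x < 1 → ∀ᶠ i in l, x ∈ A i) (hout : ∀ x, 1 < p x → ∀ᶠ i in l, x ∉ A i)
    {ε : ℝ} (hε : 0 < ε) :
    ∀ᶠ i in l, A i ⊆ (1 + ε) • p.closedBall 0 1 ∧ p.closedBall 0 1 ⊆ (1 + ε) • A i := by
  have hη : 0 < ε / 2 * δ := by positivity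
  have hs : 0 < 1 + ε / 2 := by positivity
  have hpinv (x : E) : p ((1 + ε / 2)⁻¹ • x) = (1 + ε / 2)⁻¹ * p x := by
    rw [map_smul_eq_mul, Real.norm_of_nonneg (inv_nonneg.2 hs.le)]
  have hcomp : IsCompact (p.closedBall 0 1) := by
    refine (isCompact_closedBall (0 : E) R).of_isClosed_subset ?_ ?_
    · have : p.closedBall 0 1 = p ⁻¹' Iic 1 := by
        ext x
        simp
      rw [this]
      exact isClosed_Iic.preimage hp
    · intro x hx
      exact mem_closedBall_zero_iff.2 (hpR x (by simpa using hx))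
  -- With mesh `ε / 2 * δ`, the error to a net point lies in `(ε / 2) • A i` and has `p` at most `ε
  -- / 2`. The net `T` serves the inclusion of the unit ball, `U` that of `A i`; each imposes
  -- finitely many eventual conditions.
  obtain ⟨T, hTK, hTfin, hT⟩ := hcomp.finite_cover_balls hη
  obtain ⟨U, -, hUfin, hU⟩ := (isCompact_closedBall (0 : E) R).finite_cover_balls hη
  have hTin : ∀ᶠ i in l, ∀ x ∈ T, (1 + ε / 2)⁻¹ • x ∈ A i := by
    refine hTfin.eventually_all.2 fun x hx => hin _ ?_
    have h1 : p x ≤ 1 := by simpa using hTK hx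
    rw [hpinv, inv_mul_lt_iff₀ hs]
    linarith
  have hUout : ∀ᶠ i in l, ∀ x ∈ U, (1 + ε / 2)⁻¹ • x ∈ A i → p x ≤ 1 + ε / 2 := by
    refine hUfin.eventually_all.2 fun x hx => ?_
    by_cases h : p x ≤ 1 + ε / 2
    · exact Eventually.of_forall fun _ _ => h
    · have h1 : 1 < p ((1 + ε / 2)⁻¹ • x) := by
        rw [hpinv, lt_inv_mul_iff₀ hs]
        linarith
      filter_upwards [hout _ h1] with i hi hmem using absurd hmem hi
  filter_upwards [hconv, hball, hbdd, hTin, hUout] with i hconv hball hbdd hTin hUout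
  constructor
  · intro x hx
    obtain ⟨y, hyU, hxy⟩ := mem_iUnion₂.1 (hU (hbdd hx))
    rw [Metric.mem_ball, dist_eq_norm] at hxy
    have hy : y ∈ (1 + ε / 2) • A i := by
      have h := add_mem_smul_of_norm_le hconv hball zero_le_one (half_pos hε)
        (x := x) (y := y - x) (by simpa using hx) (by rw [norm_sub_rev]; exact hxy.le)
      simpa using h
    rw [mem_smul_set_iff_inv_smul_mem₀ hs.ne'] at hy
    have hpy := hUout y hyU hy
    have hpxy : p (x - y) ≤ ε / 2 := by
      refine (hpδ _).trans (inv_mul_le_of_le_mul₀ hδ.le (by positivity) ?_)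
      linarith
    have hpx : p x ≤ 1 + ε := by
      have := map_add_le_add p (x - y) y
      rw [sub_add_cancel] at this
      linarith
    have h1 : 0 < 1 + ε := by linarith
    rw [mem_smul_set_iff_inv_smul_mem₀ h1.ne', Seminorm.mem_closedBall_zero, map_smul_eq_mul,
      Real.norm_of_nonneg (inv_nonneg.2 h1.le)]
    exact inv_mul_le_of_le_mul₀ h1.le zero_le_one (by linarith)
  · intro x hx
    obtain ⟨y, hyT, hxy⟩ := mem_iUnion₂.1 (hT hx)
    rw [Metric.mem_ball, dist_eq_norm] at hxy
    have hy := (mem_smul_set_iff_inv_smul_mem₀ hs.ne' _ _).2 (hTin y hyT)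
    have h := add_mem_smul_of_norm_le hconv hball hs.le (half_pos hε) hy hxy.le
    rwa [add_sub_cancel, add_assoc, add_halves] at h

theorem sSup_image_le_of_subset_smul {N : Seminorm ℝ E} {A B : Set E} {s : ℝ} (hs : 0 ≤ s)
    (hA : A.Nonempty) (hB : BddAbove (N '' B)) (hAB : A ⊆ s • B) :
    sSup (N '' A) ≤ s * sSup (N '' B) := by
  refine csSup_le (hA.image N) ?_
  rintro _ ⟨x, hx, rfl⟩
  obtain ⟨y, hy, rfl⟩ := hAB hx
  rw [map_smul_eq_mul, Real.norm_of_nonneg hs]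
  exact mul_le_mul_of_nonneg_left (le_csSup hB (mem_image_of_mem N hy)) hs

/-- Convergence up to dilations to a bounded set gives convergence in Hausdorff distance after
normalising by the radii. -/
theorem tendsto_hausdorffEDist_normalized {ι : Type*} {l : Filter ι} {N : Seminorm ℝ E}
    {A : ι → Set E} {K : Set E} (hK : Bornology.IsBounded K) (hNK : BddAbove (N '' K))
    (hpos : 0 < sSup (N '' K))
    (hA : ∀ ε : ℝ, 0 < ε → ∀ᶠ i in l, A i ⊆ (1 + ε) • K ∧ K ⊆ (1 + ε) • A i) :
    Tendsto (fun i => Metric.hausdorffEDist ((sSup (N '' A i))⁻¹ • A i) ((sSup (N '' K))⁻¹ • K))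
      l (𝓝 0) := by
  set r := sSup (N '' K) with hr
  have hKne : K.Nonempty := by
    by_contra h
    rw [not_nonempty_iff_eq_empty] at h
    simp [hr, h] at hpos
  obtain ⟨M, hM⟩ := hK.exists_norm_le
  have hM0 : 0 ≤ M := by
    obtain ⟨x, hx⟩ := hKne
    exact (norm_nonneg x).trans (hM x hx)
  refine ENNReal.tendsto_nhds_zero.2 fun e he => ?_
  -- After normalisation, paired points differ by a dilation of ratio between `1` and `(1 + ε)²`:
  -- one factor from the sets, one from their radii. The smaller point of each pair has norm at most
  -- `r⁻¹ * M`.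
  obtain ⟨ε, hε, hεe⟩ : ∃ ε : ℝ, 0 < ε ∧
      ENNReal.ofReal (((1 + ε) * (1 + ε) - 1) * (r⁻¹ * M)) ≤ e := by
    have hc : Tendsto (fun ε : ℝ => ENNReal.ofReal (((1 + ε) * (1 + ε) - 1) * (r⁻¹ * M)))
        (𝓝[>] 0) (𝓝 0) := by
      have : Continuous fun ε : ℝ => ENNReal.ofReal (((1 + ε) * (1 + ε) - 1) * (r⁻¹ * M)) :=
        ENNReal.continuous_ofReal.comp (by fun_prop)
      simpa using (this.tendsto 0).mono_left nhdsWithin_le_nhds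
    obtain ⟨ε, h1, h2⟩ :=
      ((ENNReal.tendsto_nhds_zero.1 hc e he).and self_mem_nhdsWithin).exists
    exact ⟨ε, h2, h1⟩
  filter_upwards [hA ε hε] with i ⟨hAK, hKA⟩
  have h1 : 0 < 1 + ε := by linarith
  set ρ := sSup (N '' A i) with hρ
  have hAne : (A i).Nonempty := by
    rw [← smul_set_nonempty (a := 1 + ε)]
    exact hKne.mono hKA
  have hNA : BddAbove (N '' A i) := by
    refine ⟨(1 + ε) * r, ?_⟩
    rintro _ ⟨x, hx, rfl⟩
    obtain ⟨y, hy, rfl⟩ := hAK hx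
    rw [map_smul_eq_mul, Real.norm_of_nonneg h1.le]
    exact mul_le_mul_of_nonneg_left (le_csSup hNK (mem_image_of_mem N hy)) h1.le
  have hρr : ρ ≤ (1 + ε) * r := sSup_image_le_of_subset_smul h1.le hAne hNK hAK
  have hrρ : r ≤ (1 + ε) * ρ := sSup_image_le_of_subset_smul h1.le hKne hNA hKA
  have hρpos : 0 < ρ := by
    by_contra h
    nlinarith
  have key {s : ℝ} {x y : E} (hs : 1 ≤ s) (hs2 : s ≤ (1 + ε) * (1 + ε)) (hxy : x = s • y)
      (hy : ‖y‖ ≤ r⁻¹ * M) : edist x y ≤ e := by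
    refine le_trans ?_ hεe
    rw [edist_dist, hxy, dist_eq_norm]
    refine ENNReal.ofReal_le_ofReal ?_
    have : s • y - y = (s - 1) • y := by rw [sub_smul, one_smul]
    rw [this, norm_smul, Real.norm_of_nonneg (by linarith)]
    exact mul_le_mul (by linarith) hy (norm_nonneg y) (by nlinarith)
  have hnorm {x : E} (hx : x ∈ K) : ‖r⁻¹ • x‖ ≤ r⁻¹ * M := by
    rw [norm_smul, Real.norm_of_nonneg (inv_nonneg.2 hpos.le)]
    exact mul_le_mul_of_nonneg_left (hM x hx) (inv_nonneg.2 hpos.le)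
  refine Metric.hausdorffEDist_le_of_mem_edist ?_ ?_
  · rintro _ ⟨x, hx, rfl⟩
    obtain ⟨y, hy, rfl⟩ := hAK hx
    refine ⟨r⁻¹ • y, smul_mem_smul_set hy, key (s := (1 + ε) * r / ρ) ?_ ?_ ?_ (hnorm hy)⟩
    · rwa [one_le_div hρpos]
    · rw [div_le_iff₀ hρpos]
      nlinarith
    · simp only [smul_smul]
      congr 1
      field_simp
  · rintro _ ⟨x, hx, rfl⟩
    obtain ⟨y, hy, hyx⟩ := hKA hx
    have hs : 1 ≤ (1 + ε) * ρ / r := by rwa [one_le_div hpos]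
    have hxy : r⁻¹ • x = ((1 + ε) * ρ / r) • ρ⁻¹ • y := by
      rw [← hyx]
      simp only [smul_smul]
      congr 1
      field_simp
    refine ⟨ρ⁻¹ • y, smul_mem_smul_set hy, key hs ?_ hxy ?_⟩
    · rw [div_le_iff₀ hpos]
      nlinarith
    -- Here the smaller point comes from `A i`; it inherits its bound from the point of `r⁻¹ • K`
    -- that dilates it.
    · refine le_trans ?_ (hnorm hx)
      rw [hxy, norm_smul ((1 + ε) * ρ / r), Real.norm_of_nonneg (by linarith)]
      exact le_mul_of_one_le_left (norm_nonneg _) hs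

end Hausdorff

theorem Seminorm.continuous_of_finiteDimensional {E : Type*} [NormedAddCommGroup E]
    [NormedSpace ℝ E] [FiniteDimensional ℝ E] (N : Seminorm ℝ E) : Continuous N := by
  rw [← continuousOn_univ]
  exact N.convexOn.continuousOn isOpen_univ

theorem EuclideanSpace.norm_le_sqrt_of_abs_le_one {d : ℕ} {x : EuclideanSpace ℝ (Fin d)}
    (hx : ∀ i, |x i| ≤ 1) : ‖x‖ ≤ √d := by
  rw [EuclideanSpace.norm_eq]
  refine Real.sqrt_le_sqrt ?_
  calc ∑ i, ‖x i‖ ^ 2 ≤ ∑ _i : Fin d, (1 : ℝ) :=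
        Finset.sum_le_sum fun i _ => pow_le_one₀ (norm_nonneg _) (hx i)
    _ = d := by simp

theorem EuclideanSpace.sum_abs_le {d : ℕ} (x : EuclideanSpace ℝ (Fin d)) :
    ∑ i, |x i| ≤ (d + 1) * ‖x‖ := by
  calc ∑ i, |x i| ≤ ∑ _i : Fin d, ‖x‖ := Finset.sum_le_sum fun i _ => PiLp.norm_apply_le x i
    _ = d * ‖x‖ := by simp
    _ ≤ (d + 1) * ‖x‖ := by nlinarith [norm_nonneg x]

/-! ### Convergence of the normalised sublevel sets -/

section Sublevel

variable {d : ℕ} {f : ℝ → ℝ}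

/-- The sublevel set of the separable potential at height `f t`, divided by `t`. -/
def scaledSublevel (d : ℕ) (f : ℝ → ℝ) (t : ℝ) : Set (EuclideanSpace ℝ (Fin d)) :=
  {x | separablePotential d f (t • x) ≤ f t}

theorem smul_scaledSublevel {t : ℝ} (ht : 0 < t) :
    t • scaledSublevel d f t = sublevel (separablePotential d f) (f t) := by
  ext x
  rw [mem_smul_set_iff_inv_smul_mem₀ ht.ne']
  simp [scaledSublevel, sublevel, smul_inv_smul₀ ht.ne']

theorem normalizedSublevel_eq (N : Seminorm ℝ (EuclideanSpace ℝ (Fin d))) {t : ℝ} (ht : 0 < t) :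
    normalizedSublevel N (separablePotential d f) (f t) =
      (sSup (N '' scaledSublevel d f t))⁻¹ • scaledSublevel d f t := by
  have h : N '' (t • scaledSublevel d f t) = t • (N '' scaledSublevel d f t) := by
    ext r
    simp only [mem_image, mem_smul_set, smul_eq_mul]
    constructor
    · rintro ⟨_, ⟨x, hx, rfl⟩, rfl⟩
      exact ⟨N x, ⟨x, hx, rfl⟩, by rw [map_smul_eq_mul, Real.norm_of_nonneg ht.le]⟩
    · rintro ⟨_, ⟨x, hx, rfl⟩, rfl⟩
      exact ⟨t • x, ⟨x, hx, rfl⟩, by rw [map_smul_eq_mul, Real.norm_of_nonneg ht.le]⟩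
  rw [normalizedSublevel, sublevelRadius, ← smul_scaledSublevel ht, h,
    Real.sSup_smul_of_nonneg ht.le, smul_smul, smul_eq_mul, mul_inv_rev,
    inv_mul_cancel_right₀ ht.ne']

variable (hf : IsEvenPotential f)
include hf

theorem IsEvenPotential.convex_scaledSublevel (t : ℝ) : Convex ℝ (scaledSublevel d f t) := by
  have h := (hf.convexOn_separable.comp_linearMap
    (LinearMap.lsmul ℝ (EuclideanSpace ℝ (Fin d)) t)).convex_le (f t)
  simpa [scaledSublevel] using h

theorem IsEvenPotential.mem_scaledSublevel_iff {x : EuclideanSpace ℝ (Fin d)} {t : ℝ}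
    (ht : 0 < t) : x ∈ scaledSublevel d f t ↔ scaledInverse f x t ≤ 1 := by
  rw [hf.scaledInverse_le_iff ht zero_le_one, mul_one]
  rfl

theorem IsEvenPotential.eventually_scaledSublevel_subset
    {h : Seminorm ℝ (EuclideanSpace ℝ (Fin d))}
    (hlim : ∀ x, Tendsto (scaledInverse f x) atTop (𝓝 (h x)))
    (hlow : ∀ x i, |x i| ≤ h x) (hup : ∀ x, h x ≤ ∑ i, |x i|) {ε : ℝ} (hε : 0 < ε) :
    ∀ᶠ t in atTop, scaledSublevel d f t ⊆ (1 + ε) • h.closedBall 0 1 ∧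
      h.closedBall 0 1 ⊆ (1 + ε) • scaledSublevel d f t := by
  have hd : (0 : ℝ) < d + 1 := by positivity
  -- The `ℓ^1` bound gives the inner radius, with `d + 1` in place of `d` to stay positive when `d =
  -- 0`; the `ℓ^∞` bound gives the outer radius `√d`.
  refine eventually_subset_smul_closedBall (δ := ((d : ℝ) + 1)⁻¹) (R := √d) (inv_pos.2 hd)
    h.continuous_of_finiteDimensional (fun x => ?_) (fun x hx => ?_) ?_ ?_ ?_ (fun x hx => ?_)
    (fun x hx => ?_) hε
  · rw [inv_inv]
    exact (hup x).trans (EuclideanSpace.sum_abs_le x)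
  · exact EuclideanSpace.norm_le_sqrt_of_abs_le_one fun i => (hlow x i).trans hx
  · exact Eventually.of_forall hf.convex_scaledSublevel
  · filter_upwards [eventually_gt_atTop 0] with t ht x hx
    rw [hf.mem_scaledSublevel_iff ht]
    refine (hf.scaledInverse_le x ht).trans ((EuclideanSpace.sum_abs_le x).trans ?_)
    rw [← le_inv_mul_iff₀ hd, mul_one]
    exact mem_closedBall_zero_iff.1 hx
  · filter_upwards [eventually_gt_atTop 0] with t ht x hx
    rw [hf.mem_scaledSublevel_iff ht] at hx
    exact mem_closedBall_zero_iff.2 (EuclideanSpace.norm_le_sqrt_of_abs_le_one fun i =>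
      (hf.abs_le_scaledInverse x i ht).trans hx)
  · filter_upwards [eventually_gt_atTop 0, (hlim x).eventually_le_const hx] with t ht h1
    exact (hf.mem_scaledSublevel_iff ht).2 h1
  · filter_upwards [eventually_gt_atTop 0, (hlim x).eventually_const_lt hx] with t ht h1
    rw [hf.mem_scaledSublevel_iff ht]
    exact not_le.2 h1

theorem IsEvenPotential.tendsto_normalizedSublevel {N h : Seminorm ℝ (EuclideanSpace ℝ (Fin d))}
    (hlim : ∀ x, Tendsto (scaledInverse f x) atTop (𝓝 (h x)))
    (hlow : ∀ x i, |x i| ≤ h x) (hup : ∀ x, h x ≤ ∑ i, |x i|)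
    (hK : IsCompact (h.closedBall 0 1)) (hpos : 0 < sSup (N '' h.closedBall 0 1)) :
    IsHorizonShape N (separablePotential d f)
      ((sSup (N '' h.closedBall 0 1))⁻¹ • h.closedBall 0 1) := by
  refine ⟨hK.smul _, ?_⟩
  have h1 := tendsto_hausdorffEDist_normalized hK.isBounded
    (hK.image N.continuous_of_finiteDimensional).bddAbove hpos
    fun ε hε => hf.eventually_scaledSublevel_subset hlim hlow hup hε
  -- Each level `c ≥ 0` is `f t` with `t` its nonnegative inverse, which tends to infinity with `c`.
  refine (h1.comp hf.tendsto_inverse).congr' ?_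
  filter_upwards [eventually_ge_atTop 0, hf.tendsto_inverse.eventually_gt_atTop 0] with c hc ht
  rw [Function.comp_apply, ← normalizedSublevel_eq N ht, hf.apply_inverse hc]

/-- In dimension zero every radius vanishes and normalisation by it is vacuous; a nonempty set is
the whole space. -/
theorem IsEvenPotential.isHorizonShape_of_subsingleton
    [Subsingleton (EuclideanSpace ℝ (Fin d))] (N : Seminorm ℝ (EuclideanSpace ℝ (Fin d))) :
    IsHorizonShape N (separablePotential d f) univ := by
  refine ⟨isCompact_univ, tendsto_const_nhds.congr' ?_⟩
  filter_upwards [eventually_ge_atTop 0] with c hc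
  have hne : (normalizedSublevel N (separablePotential d f) c).Nonempty :=
    Set.Nonempty.smul_set ⟨0, by simpa [sublevel, hf.separable_zero] using hc⟩
  rw [Subsingleton.eq_univ_of_nonempty hne, Metric.hausdorffEDist_self]

end Sublevel

/-! ### The horizon function as a gauge, and the conclusion -/

theorem sInf_pos_and_le {a : ℝ} (ha : 0 ≤ a) : sInf {r : ℝ | 0 < r ∧ a ≤ r} = a := by
  rcases ha.eq_or_lt with rfl | ha
  · have : {r : ℝ | 0 < r ∧ 0 ≤ r} = Ioi 0 := by
      ext r
      exact ⟨fun h => h.1, fun h => ⟨h, le_of_lt h⟩⟩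
    rw [this, csInf_Ioi]
  · have : {r : ℝ | 0 < r ∧ a ≤ r} = Ici a := by
      ext r
      exact ⟨fun h => h.2, fun h => ⟨ha.trans_le h, h⟩⟩
    rw [this, csInf_Ici]

theorem horizonFunction_inv_smul_closedBall {E : Type*} [NormedAddCommGroup E] [NormedSpace ℝ E]
    (h : Seminorm ℝ E) {ρ : ℝ} (hρ : 0 < ρ) (x : E) :
    horizonFunction (ρ⁻¹ • h.closedBall 0 1) x = ρ * h x := by
  rw [← sInf_pos_and_le (mul_nonneg hρ.le (apply_nonneg h x)), horizonFunction]
  congr 1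
  ext r
  refine and_congr_right fun hr => ?_
  rw [mem_smul_set_iff_inv_smul_mem₀ (inv_ne_zero hρ.ne'), inv_inv,
    Seminorm.mem_closedBall_zero, map_smul_eq_mul, map_smul_eq_mul, Real.norm_of_nonneg hρ.le,
    Real.norm_of_nonneg (inv_nonneg.2 hr.le), mul_left_comm, inv_mul_le_iff₀ hr, mul_one]

theorem SeparableAssumptions.eventually_le_or_lt {L : FirstOrder.Language} [L.Structure ℝ]
    (hL : IsOMinimalOnReals L) {f : ℝ → ℝ} (hf : SeparableAssumptions L f) {d : ℕ}
    (x : EuclideanSpace ℝ (Fin d)) (a : ℝ) :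
    (∀ᶠ t in atTop, separablePotential d f (t • x) ≤ f (t * a)) ∨
      ∀ᶠ t in atTop, f (t * a) < separablePotential d f (t • x) :=
  hL.eventually_le_or_lt
    (hL.definableFun_sum Finset.univ fun i => hL.definableFun_comp_mul hf.definable (x i))
    (hL.definableFun_comp_mul hf.definable a)

/-- Let `φ(β) = ∑ i, φ₁(β i)` on `ℝ^d`, with `φ₁` as in `SeparableAssumptions`, and let `N` be any
norm on `ℝ^d`. Then `φ₁` is a bijection of `ℝ≥0`, the potential `φ` has a horizon shape `S`, which
is non-degenerate, and its horizon function is, up to a factor `lam > 0`, the pointwise limit of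
`η * φ₁⁻¹ (φ (β / η))` as `η → 0⁺`, which exists. -/
theorem theorem4p4 (L : FirstOrder.Language) [L.Structure ℝ] (hL : IsOMinimalOnReals L)
    (d : ℕ) (N : Seminorm ℝ (EuclideanSpace ℝ (Fin d))) (hN : ∀ β, N β = 0 → β = 0)
    (φ₁ : ℝ → ℝ) (hφ₁ : SeparableAssumptions L φ₁) :
    BijOn φ₁ (Ici 0) (Ici 0) ∧
    ∃ S : Set (EuclideanSpace ℝ (Fin d)),
      IsHorizonShape N (separablePotential d φ₁) S ∧
      0 ∈ interior S ∧
      ∃ lam : ℝ, 0 < lam ∧ ∀ β : EuclideanSpace ℝ (Fin d), ∃ l : ℝ,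
        Tendsto (fun η : ℝ => η * nonnegInverse φ₁ (separablePotential d φ₁ (η⁻¹ • β)))
          (𝓝[>] 0) (𝓝 l) ∧
        horizonFunction S β = lam * l := by
  have hf := hφ₁.isEvenPotential
  obtain ⟨h, hlim, hlow, hup⟩ := hf.exists_seminorm_tendsto (d := d)
    fun x a _ => hφ₁.eventually_le_or_lt hL x a
  have hlim0 (β : EuclideanSpace ℝ (Fin d)) :
      Tendsto (fun η : ℝ => η * nonnegInverse φ₁ (separablePotential d φ₁ (η⁻¹ • β)))
        (𝓝[>] 0) (𝓝 (h β)) := by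
    refine ((hlim β).comp tendsto_inv_nhdsGT_zero).congr fun η => ?_
    rw [Function.comp_apply, scaledInverse, inv_inv]
  have hcont := h.continuous_of_finiteDimensional
  refine ⟨hf.bijOn, ?_⟩
  -- A nonzero vector is needed for the unit ball of `h` to have positive radius, which is the
  -- factor `lam`.
  cases subsingleton_or_nontrivial (EuclideanSpace ℝ (Fin d)) with
  | inl hsub =>
    refine ⟨univ, hf.isHorizonShape_of_subsingleton N, by simp, 1, one_pos, fun β =>
      ⟨h β, hlim0 β, ?_⟩⟩
    rw [Subsingleton.elim β 0, map_zero, mul_zero]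
    simp only [horizonFunction, mem_univ, and_true]
    exact csInf_Ioi
  | inr hnt =>
    have hK : IsCompact (h.closedBall 0 1) := by
      refine (isCompact_closedBall (0 : EuclideanSpace ℝ (Fin d)) (√d)).of_isClosed_subset ?_ ?_
      · simpa [Seminorm.closedBall_zero_eq] using isClosed_le hcont continuous_const
      · exact fun x hx => mem_closedBall_zero_iff.2
          (EuclideanSpace.norm_le_sqrt_of_abs_le_one fun i =>
            (hlow x i).trans (h.mem_closedBall_zero.1 hx))
    have hpos : 0 < sSup (N '' h.closedBall 0 1) := by
      obtain ⟨x, hx⟩ := exists_ne (0 : EuclideanSpace ℝ (Fin d))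
      have hc : 0 < h x + 1 := by linarith [apply_nonneg h x]
      have hy : (h x + 1)⁻¹ • x ∈ h.closedBall 0 1 := by
        rw [h.mem_closedBall_zero, map_smul_eq_mul,
          Real.norm_of_nonneg (inv_nonneg.2 hc.le), inv_mul_le_iff₀ hc]
        linarith
      refine lt_of_lt_of_le ?_ (le_csSup
        (hK.image N.continuous_of_finiteDimensional).bddAbove (mem_image_of_mem N hy))
      refine lt_of_le_of_ne (apply_nonneg _ _) fun h0 => ?_
      exact smul_ne_zero (inv_ne_zero hc.ne') hx (hN _ h0.symm)
    refine ⟨_, hf.tendsto_normalizedSublevel hlim hlow hup hK hpos, ?_, _, hpos, fun β =>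
      ⟨h β, hlim0 β, horizonFunction_inv_smul_closedBall h hpos β⟩⟩
    rw [mem_interior_iff_mem_nhds]
    refine set_smul_mem_nhds_zero_iff (inv_ne_zero hpos.ne') |>.2 ?_
    refine mem_of_superset (hcont.continuousAt.preimage_mem_nhds
      (Iio_mem_nhds (show h 0 < 1 by simp))) fun x hx => ?_
    exact h.mem_closedBall_zero.2 (le_of_lt hx)
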